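/- Let $\sigma\ge 0$, $P\ge 0$. For a blocklength $m\ge 1$ and a rate $R\ge 0$, let the host signal $\mathbf X_0\sim\mathcal N(0,\sigma^2 I_m)$, the channel noise $\mathbf Z\sim\mathcal N(0,I_m)$ and the message $M$, uniform on $\{1,\dots,\lfloor 2^{mR}\rfloor\}$, be mutually independent. An encoder $\mathcal E_m$ is a (measurable) map $(M,\mathbf X_0)\mapsto\mathbf X_1\in\mathbb R^m$ that satisfies, for each value of the message, the power constraint $\mathbb E\|\mathbf X_0-\mathbf X_1\|^2\le mP$. A decoder $\mathcal D_m$ is a (measurable) map that sends $\mathbf Y=\mathbf X_1+\mathbf Z$ to a pair $(\widehat{\mathbf X}_1,\widehat M)$ consisting of estimates of $\mathbf X_1$ and of $M$. Put $d(\mathbf x,\mathbf y)=\frac1m\|\mathbf x-\mathbf y\|^2$ (Euclidean norm) and $$\mathrm{MMSE}(P,R)=\inf\ \limsup_{m\to\infty}\ \mathbb E\,d(\mathbf X_1,\widehat{\mathbf X}_1),$$ where the infimum is over all sequences $\{\mathcal E_m,\mathcal D_m\}_{m\ge1}$ of such encoders and decoders with $\Pr(M\ne\widehat M)\to0$. For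 $R=0$ (the vector Witsenhausen counterexample) there is only one message. Let $$L(\sigma,P)=\inf_{|\sigma_{XV}|\le\sigma\sqrt P}\ \sup_{\gamma\in\mathbb R\setminus\{0\}}\ \frac1{\gamma^2}\left(\left(\sqrt{\frac{\sigma^2}{1+\sigma^2+P+2\sigma_{XV}}}-\sqrt{(1-\gamma)^2\sigma^2+\gamma^2P-2\gamma(1-\gamma)\sigma_{XV}}\right)^+\right)^2,$$ where $x^+=\max(x,0)$. Then $$\mathrm{MMSE}(P,0)\ \ge\ L(\sigma,P).$$ Further, the bound holds at every blocklength and not just asymptotically: for every $m\ge1$ and every encoder-decoder pair $(\mathcal E_m,\mathcal D_m)$ at rate $R=0$ that satisfies the power constraint, $\mathbb E\,d(\mathbf X_1,\widehat{\mathbf X}_1)\ge L(\sigma,P)$. -/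

import Mathlib

open MeasureTheory ProbabilityTheory Filter Topology
open scoped NNReal ENNReal

noncomputable section

namespace InfoEmbedding

/-- White Gaussian law `N(0, v I)` on `ℝ^m` (`v` is the variance of each coordinate). -/
def whiteGaussian (m : ℕ) (v : ℝ≥0) : Measure (Fin m → ℝ) :=
  Measure.pi fun _ => gaussianReal 0 v

/-- Squared Euclidean distance `‖x - y‖²` on `ℝ^m`. -/
def sqDist {m : ℕ} (x y : Fin m → ℝ) : ℝ := ∑ i, (x i - y i) ^ 2

/-- Number of messages `2^{mR}` at blocklength `m` and rate `R` (rounded down when it is not an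
integer; it equals `1` when `R = 0`). -/
def numMessages (m : ℕ) (R : ℝ) : ℕ := ⌊(2 : ℝ) ^ ((m : ℝ) * R)⌋₊

/-- An encoder-decoder pair of blocklength `m` with `N` messages.  The encoder maps the message and
the host signal to the modified host signal; the decoder maps the channel output to an estimate of
the modified host signal and an estimate of the message. -/
structure Code (m N : ℕ) where
  encode : Fin N → (Fin m → ℝ) → (Fin m → ℝ)
  measurable_encode : ∀ k, Measurable (encode k)
  decodeHost : (Fin m → ℝ) → (Fin m → ℝ)
  measurable_decodeHost : Measurable decodeHost
  decodeMsg : (Fin m → ℝ) → Fin N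
  measurable_decodeMsg : Measurable decodeMsg

/-- Joint law of `(M, X₀, Z)`: uniform message, host `N(0, σ² I)`, channel noise `N(0, I)`,
mutually independent. -/
def sourceLaw (m N : ℕ) (σ : ℝ≥0) : Measure (Fin N × (Fin m → ℝ) × (Fin m → ℝ)) :=
  (uniformOn (Set.univ : Set (Fin N))).prod ((whiteGaussian m (σ ^ 2)).prod (whiteGaussian m 1))

namespace Code

variable {m N : ℕ}

/-- The modified host signal `X₁`, as a function of `(M, X₀, Z)`. -/
def modifiedHost (c : Code m N) (ω : Fin N × (Fin m → ℝ) × (Fin m → ℝ)) : Fin m → ℝ :=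
  c.encode ω.1 ω.2.1

/-- The channel output `Y = X₁ + Z`, as a function of `(M, X₀, Z)`. -/
def channelOutput (c : Code m N) (ω : Fin N × (Fin m → ℝ) × (Fin m → ℝ)) : Fin m → ℝ :=
  c.modifiedHost ω + ω.2.2

/-- For each message, the input `V = X₁ - X₀` satisfies `E ‖X₀ - X₁‖² ≤ m P`. -/
def PowerConstraint (c : Code m N) (σ P : ℝ≥0) : Prop :=
  ∀ k : Fin N,
    ∫⁻ x₀, ENNReal.ofReal (sqDist x₀ (c.encode k x₀)) ∂(whiteGaussian m (σ ^ 2))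
      ≤ (m : ℝ≥0∞) * (P : ℝ≥0∞)

/-- Error probability `Pr(M ≠ M̂)`. -/
def errorProb (c : Code m N) (σ : ℝ≥0) : ℝ≥0∞ :=
  sourceLaw m N σ {ω | ω.1 ≠ c.decodeMsg (c.channelOutput ω)}

/-- Average distortion `E d(X₁, X̂₁) = (1/m) E ‖X₁ - X̂₁‖²`, possibly `∞`. -/
def distortion (c : Code m N) (σ : ℝ≥0) : ℝ≥0∞ :=
  (∫⁻ ω, ENNReal.ofReal (sqDist (c.modifiedHost ω) (c.decodeHost (c.channelOutput ω)))
    ∂(sourceLaw m N σ)) / (m : ℝ≥0∞)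

end Code

/-- Minimum asymptotic distortion `MMSE(P, R)`: infimum, over sequences of codes of rate `R` that
meet the power constraint and whose error probability tends to `0`, of the limit superior of the
average distortion.  (The term of index `m = 0` of a sequence plays no role.) -/
def MMSE (σ P : ℝ≥0) (R : ℝ) : ℝ≥0∞ :=
  ⨅ (c : (m : ℕ) → Code m (numMessages m R))
    (_ : ∀ m, (c m).PowerConstraint σ P)
    (_ : Tendsto (fun m => (c m).errorProb σ) atTop (𝓝 0)),
    limsup (fun m => (c m).distortion σ) atTop

/-- The function whose sup over `γ` and inf over `s = σ_XV` is the lower bound. -/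
def boundTerm (σ P : ℝ≥0) (s γ : ℝ) : ℝ :=
  1 / γ ^ 2 *
    (max (√((σ : ℝ) ^ 2 / (1 + (σ : ℝ) ^ 2 + P + 2 * s))
      - √((1 - γ) ^ 2 * (σ : ℝ) ^ 2 + γ ^ 2 * P - 2 * γ * (1 - γ) * s)) 0) ^ 2

/-- `inf_{|s| ≤ σ √P} sup_γ boundTerm`, with values in `[0, ∞]`.  The supremum is over `γ ≠ 0`; at
`γ = 0` the positive part in `boundTerm` vanishes for every admissible `s`. -/
def lowerBound (σ P : ℝ≥0) : ℝ≥0∞ :=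
  ⨅ (s : ℝ) (_ : |s| ≤ (σ : ℝ) * √(P : ℝ)), ⨆ (γ : ℝ) (_ : γ ≠ 0),
    ENNReal.ofReal (boundTerm σ P s γ)

end InfoEmbedding

end

/-! Write `x`, `y`, `z` for the host, the modified host and the noise, and `y'` for the estimate of
`y` from `y + z`. For every function `g` of the channel output the map
`(x, z) ↦ (x - g (y + z), y + z)` is a composition of shears, hence preserves Lebesgue measure, so
the image of the Gaussian law of `(x, z)` has the same differential entropy as that law. Gibbs'
inequality against a product of two white Gaussian densities of the matching variances then gives
`m² σ² ≤ E ‖x - g (y + z)‖² · E ‖y + z‖²`; this replaces the rate-distortion and channel coding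
theorems at a fixed blocklength and needs no joint density of the host and its estimate.

Take `g = γ y'`, so that the first factor is `E ‖x - γ y'‖²`. In `L²` the triangle inequality
`‖x - γ y'‖ ≤ ‖x - γ y‖ + |γ| ‖y - y'‖` bounds `‖y - y'‖` from below in terms of the covariance of
`x` and `y - x`, for each `γ` separately. The message is a parameter throughout, so averaging over
it gives the same bound at every rate. -/

namespace InfoEmbedding

open WithLp (toLp)

open scoped RealInnerProductSpace

section SecondMoments

variable {Ω : Type*} [MeasurableSpace Ω] {μ : Measure Ω}
  {E : Type*} [NormedAddCommGroup E] [InnerProductSpace ℝ E]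

theorem norm_sq_toLp {F : Type*} [NormedAddCommGroup F] {u : Ω → F} (hu : MemLp u 2 μ) :
    ‖hu.toLp u‖ ^ 2 = ∫ ω, ‖u ω‖ ^ 2 ∂μ := by
  rw [Lp.norm_toLp, hu.eLpNorm_eq_integral_rpow_norm two_ne_zero ENNReal.ofNat_ne_top,
    ENNReal.toReal_ofReal (by positivity), ENNReal.toReal_ofNat, ← Real.rpow_natCast,
    ← Real.rpow_mul (by positivity)]
  norm_num

theorem ofReal_norm_sq_toLp {F : Type*} [NormedAddCommGroup F] {u : Ω → F} (hu : MemLp u 2 μ) :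
    ENNReal.ofReal (‖hu.toLp u‖ ^ 2) = ∫⁻ ω, ENNReal.ofReal (‖u ω‖ ^ 2) ∂μ := by
  rw [norm_sq_toLp, ofReal_integral_eq_lintegral_ofReal (hu.integrable_norm_pow two_ne_zero)
    (Eventually.of_forall fun ω => sq_nonneg ‖u ω‖)]

theorem memLp_two_of_lintegral_norm_sq_ne_top {F : Type*} [NormedAddCommGroup F] {u : Ω → F}
    (hu : AEStronglyMeasurable u μ) (h : ∫⁻ ω, ENNReal.ofReal (‖u ω‖ ^ 2) ∂μ ≠ ∞) :
    MemLp u 2 μ :=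
  (memLp_two_iff_integrable_sq_norm hu).2 <|
    (lintegral_ofReal_ne_top_iff_integrable (hu.norm.pow 2)
      (Eventually.of_forall fun ω => sq_nonneg ‖u ω‖)).1 h

theorem integral_norm_const_add_sq [CompleteSpace E] [IsProbabilityMeasure μ] {w : Ω → E}
    (hw : MemLp w 2 μ) (hw0 : ∫ ω, w ω ∂μ = 0) (a : E) :
    ∫ ω, ‖a + w ω‖ ^ 2 ∂μ = ‖a‖ ^ 2 + ∫ ω, ‖w ω‖ ^ 2 ∂μ := by
  have hw1 := hw.integrable one_le_two
  have hcross : Integrable (fun ω => 2 * ⟪a, w ω⟫) μ := (hw1.const_inner a).const_mul 2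
  calc ∫ ω, ‖a + w ω‖ ^ 2 ∂μ
      = ∫ ω, (‖a‖ ^ 2 + 2 * ⟪a, w ω⟫ + ‖w ω‖ ^ 2) ∂μ := by simp only [norm_add_sq_real]
    _ = ‖a‖ ^ 2 + 2 * ⟪a, ∫ ω, w ω ∂μ⟫ + ∫ ω, ‖w ω‖ ^ 2 ∂μ := by
      rw [integral_add (by fun_prop) (hw.integrable_norm_pow two_ne_zero),
        integral_add (integrable_const _) hcross, integral_const_mul, integral_inner hw1]
      simp
    _ = ‖a‖ ^ 2 + ∫ ω, ‖w ω‖ ^ 2 ∂μ := by simp [hw0]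

theorem integral_prod_norm_add_sq [CompleteSpace E] [IsProbabilityMeasure μ]
    {Ω' : Type*} [MeasurableSpace Ω'] {ν : Measure Ω'} [IsProbabilityMeasure ν]
    {u : Ω → E} {w : Ω' → E} (hu : MemLp u 2 μ) (hw : MemLp w 2 ν) (hw0 : ∫ z, w z ∂ν = 0) :
    ∫ p, ‖u p.1 + w p.2‖ ^ 2 ∂μ.prod ν = ∫ x, ‖u x‖ ^ 2 ∂μ + ∫ z, ‖w z‖ ^ 2 ∂ν := by
  have hint : Integrable (fun p : Ω × Ω' => ‖u p.1 + w p.2‖ ^ 2) (μ.prod ν) :=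
    ((hu.comp_fst ν).add (hw.comp_snd μ)).integrable_norm_pow two_ne_zero
  rw [integral_prod _ hint]
  simp only [integral_norm_const_add_sq hw hw0]
  rw [integral_add (hu.integrable_norm_pow two_ne_zero) (integrable_const _)]
  simp

end SecondMoments

section Gibbs

variable {Ω : Type*} [MeasurableSpace Ω] {κ : Measure Ω} {p q : Ω → ℝ}

theorem lintegral_withDensity_div (hp : Measurable p) (hp0 : ∀ x, 0 < p x) (hq : Measurable q) :
    ∫⁻ x, ENNReal.ofReal (q x / p x) ∂κ.withDensity (fun x => ENNReal.ofReal (p x)) =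
      ∫⁻ x, ENNReal.ofReal (q x) ∂κ := by
  rw [lintegral_withDensity_eq_lintegral_mul _ hp.ennreal_ofReal (by fun_prop)]
  refine lintegral_congr fun x => ?_
  rw [Pi.mul_apply, ← ENNReal.ofReal_mul (hp0 x).le, mul_div_cancel₀ _ (hp0 x).ne']

theorem integral_log_le_integral_log {μ : Measure Ω} [IsProbabilityMeasure μ]
    (hμ : μ = κ.withDensity fun x => ENNReal.ofReal (p x))
    (hp : Measurable p) (hp0 : ∀ x, 0 < p x) (hq : Measurable q) (hq0 : ∀ x, 0 < q x)
    (hq1 : ∫⁻ x, ENNReal.ofReal (q x) ∂κ ≤ 1)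
    (hlogp : Integrable (fun x => Real.log (p x)) μ)
    (hlogq : Integrable (fun x => Real.log (q x)) μ) :
    ∫ x, Real.log (q x) ∂μ ≤ ∫ x, Real.log (p x) ∂μ := by
  have hratio0 : 0 ≤ᵐ[μ] fun x => q x / p x :=
    Eventually.of_forall fun x => (div_pos (hq0 x) (hp0 x)).le
  have hratio1 : ∫⁻ x, ENNReal.ofReal (q x / p x) ∂μ ≤ 1 := by
    rwa [hμ, lintegral_withDensity_div hp hp0 hq]
  have hratio : Integrable (fun x => q x / p x) μ :=
    (lintegral_ofReal_ne_top_iff_integrable (hq.div hp).aestronglyMeasurable hratio0).1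
      (ne_top_of_le_ne_top ENNReal.one_ne_top hratio1)
  have hmean : ∫ x, q x / p x ∂μ ≤ 1 := by
    rwa [← ENNReal.ofReal_le_one, ofReal_integral_eq_lintegral_ofReal hratio hratio0]
  have hlog (x : Ω) : Real.log (q x) - Real.log (p x) ≤ q x / p x - 1 := by
    rw [← Real.log_div (hq0 x).ne' (hp0 x).ne']
    exact Real.log_le_sub_one_of_pos (div_pos (hq0 x) (hp0 x))
  have hle := integral_mono (hlogq.sub hlogp) (hratio.sub (integrable_const 1)) hlog
  rw [integral_sub' hlogq hlogp, integral_sub' hratio (integrable_const 1), integral_const,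
    probReal_univ, one_smul] at hle
  linarith

end Gibbs

section Gaussian

variable {m : ℕ}

instance isProbabilityMeasure_whiteGaussian (m : ℕ) (v : ℝ≥0) :
    IsProbabilityMeasure (whiteGaussian m v) := by
  unfold whiteGaussian
  infer_instance

/-- The density of `N(0, v I)` on `ℝ^m` with respect to Lebesgue measure, for `v ≠ 0`. -/
noncomputable def whiteGaussianPDF (v : ℝ≥0) (x : Fin m → ℝ) : ℝ := ∏ i, gaussianPDFReal 0 v (x i)

@[fun_prop]
theorem measurable_whiteGaussianPDF (v : ℝ≥0) :
    Measurable (whiteGaussianPDF v : (Fin m → ℝ) → ℝ) :=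
  Finset.measurable_fun_prod _ fun i _ =>
    (measurable_gaussianPDFReal 0 v).comp (measurable_pi_apply i)

theorem whiteGaussianPDF_pos {v : ℝ≥0} (hv : v ≠ 0) (x : Fin m → ℝ) : 0 < whiteGaussianPDF v x :=
  Finset.prod_pos fun _ _ => gaussianPDFReal_pos _ _ _ hv

theorem log_gaussianPDFReal {v : ℝ≥0} (hv : v ≠ 0) (a t : ℝ) :
    Real.log (gaussianPDFReal a v t) =
      -(Real.log (2 * Real.pi * v) / 2) - (t - a) ^ 2 / (2 * v) := by
  have : 0 < v := pos_iff_ne_zero.2 hv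
  rw [gaussianPDFReal, Real.log_mul (by positivity) (Real.exp_pos _).ne', Real.log_exp,
    Real.log_inv, Real.log_sqrt (by positivity)]
  ring

theorem log_whiteGaussianPDF {v : ℝ≥0} (hv : v ≠ 0) (x : Fin m → ℝ) :
    Real.log (whiteGaussianPDF v x) =
      -(m / 2 * Real.log (2 * Real.pi * v)) - ‖toLp 2 x‖ ^ 2 / (2 * v) := by
  rw [whiteGaussianPDF, Real.log_prod fun i _ => (gaussianPDFReal_pos _ _ _ hv).ne']
  simp only [log_gaussianPDFReal hv, sub_zero, Finset.sum_sub_distrib, Finset.sum_const,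
    Finset.card_univ, Fintype.card_fin, nsmul_eq_mul, EuclideanSpace.real_norm_sq_eq,
    Finset.sum_div]
  ring

theorem whiteGaussian_eq_withDensity {v : ℝ≥0} (hv : v ≠ 0) :
    whiteGaussian m v = volume.withDensity fun x => ENNReal.ofReal (whiteGaussianPDF v x) := by
  refine Measure.pi_eq fun s hs => ?_
  rw [withDensity_apply _ (MeasurableSet.univ_pi hs), volume_pi, Measure.restrict_pi_pi,
    ← ofReal_integral_eq_lintegral_ofReal (f := whiteGaussianPDF v)
      (Integrable.fintype_prod_dep fun _ => (integrable_gaussianPDFReal 0 v).restrict)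
      (Eventually.of_forall fun x => (whiteGaussianPDF_pos hv x).le)]
  simp only [whiteGaussianPDF]
  rw [integral_fintype_prod_eq_prod (fun _ => gaussianPDFReal 0 v),
    ENNReal.ofReal_prod_of_nonneg fun i _ => integral_nonneg (gaussianPDFReal_nonneg 0 v)]
  exact Finset.prod_congr rfl fun i _ => (gaussianReal_apply_eq_integral 0 hv (s i)).symm

theorem memLp_eval_whiteGaussian (v : ℝ≥0) (i : Fin m) :
    MemLp (fun x : Fin m → ℝ => x i) 2 (whiteGaussian m v) :=
  (memLp_id_gaussianReal 2).comp_measurePreserving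
    (measurePreserving_eval (fun _ : Fin m => gaussianReal 0 v) i)

theorem integral_eval_whiteGaussian (v : ℝ≥0) (i : Fin m) :
    ∫ x, x i ∂whiteGaussian m v = 0 := by
  rw [whiteGaussian, integral_comp_eval (μ := fun _ : Fin m => gaussianReal 0 v) (f := fun t => t)
    aestronglyMeasurable_id, integral_id_gaussianReal]

theorem integral_eval_sq_whiteGaussian (v : ℝ≥0) (i : Fin m) :
    ∫ x, x i ^ 2 ∂whiteGaussian m v = v := by
  rw [whiteGaussian, integral_comp_eval (μ := fun _ : Fin m => gaussianReal 0 v)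
      (f := fun t => t ^ 2) (by fun_prop)]
  simpa only [id_eq] using (variance_of_integral_eq_zero aemeasurable_id
    integral_id_gaussianReal).symm.trans (variance_id_gaussianReal (μ := 0) (v := v))

theorem memLp_toLp_whiteGaussian (m : ℕ) (v : ℝ≥0) :
    MemLp (fun x : Fin m → ℝ => toLp 2 x) 2 (whiteGaussian m v) :=
  memLp_piLp_iff.2 (memLp_eval_whiteGaussian v)

theorem integral_toLp_whiteGaussian (m : ℕ) (v : ℝ≥0) :
    ∫ x : Fin m → ℝ, toLp 2 x ∂whiteGaussian m v = 0 := by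
  ext i
  rw [eval_integral_piLp fun i => (memLp_eval_whiteGaussian v i).integrable one_le_two]
  exact integral_eval_whiteGaussian v i

theorem integral_norm_sq_whiteGaussian (m : ℕ) (v : ℝ≥0) :
    ∫ x : Fin m → ℝ, ‖toLp 2 x‖ ^ 2 ∂whiteGaussian m v = m * v := by
  simp only [EuclideanSpace.real_norm_sq_eq]
  rw [integral_finsetSum _ fun i _ => (memLp_eval_whiteGaussian v i).integrable_sq]
  simp [integral_eval_sq_whiteGaussian]

end Gaussian

section EntropyBound

variable {m : ℕ}

/-- The density of `N(0, v I) ⊗ N(0, w I)` on `ℝ^m × ℝ^m`, for `v ≠ 0` and `w ≠ 0`. -/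
noncomputable def whiteGaussianProdPDF (v w : ℝ≥0) (p : (Fin m → ℝ) × (Fin m → ℝ)) : ℝ :=
  whiteGaussianPDF v p.1 * whiteGaussianPDF w p.2

@[fun_prop]
theorem measurable_whiteGaussianProdPDF (v w : ℝ≥0) :
    Measurable (whiteGaussianProdPDF v w : (Fin m → ℝ) × (Fin m → ℝ) → ℝ) := by
  unfold whiteGaussianProdPDF
  fun_prop

theorem whiteGaussianProdPDF_pos {v w : ℝ≥0} (hv : v ≠ 0) (hw : w ≠ 0)
    (p : (Fin m → ℝ) × (Fin m → ℝ)) : 0 < whiteGaussianProdPDF v w p :=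
  mul_pos (whiteGaussianPDF_pos hv p.1) (whiteGaussianPDF_pos hw p.2)

theorem whiteGaussian_prod_eq_withDensity {v w : ℝ≥0} (hv : v ≠ 0) (hw : w ≠ 0) :
    (whiteGaussian m v).prod (whiteGaussian m w) =
      volume.withDensity fun p => ENNReal.ofReal (whiteGaussianProdPDF v w p) := by
  rw [whiteGaussian_eq_withDensity hv, whiteGaussian_eq_withDensity hw,
    prod_withDensity (by fun_prop) (by fun_prop), ← Measure.volume_eq_prod]
  simp only [whiteGaussianProdPDF, ENNReal.ofReal_mul (whiteGaussianPDF_pos hv _).le]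

theorem lintegral_whiteGaussianProdPDF {v w : ℝ≥0} (hv : v ≠ 0) (hw : w ≠ 0) :
    ∫⁻ p : (Fin m → ℝ) × (Fin m → ℝ), ENNReal.ofReal (whiteGaussianProdPDF v w p) = 1 := by
  rw [← setLIntegral_univ, ← withDensity_apply _ MeasurableSet.univ,
    ← whiteGaussian_prod_eq_withDensity hv hw, measure_univ]

theorem log_whiteGaussianProdPDF {v w : ℝ≥0} (hv : v ≠ 0) (hw : w ≠ 0)
    (p : (Fin m → ℝ) × (Fin m → ℝ)) :
    Real.log (whiteGaussianProdPDF v w p) =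
      -(m / 2 * (Real.log (2 * Real.pi * v) + Real.log (2 * Real.pi * w))) -
        (‖toLp 2 p.1‖ ^ 2 / (2 * v) + ‖toLp 2 p.2‖ ^ 2 / (2 * w)) := by
  rw [whiteGaussianProdPDF, Real.log_mul (whiteGaussianPDF_pos hv _).ne'
    (whiteGaussianPDF_pos hw _).ne', log_whiteGaussianPDF hv, log_whiteGaussianPDF hw]
  ring

section CrossEntropy

variable {Ω : Type*} [MeasurableSpace Ω] {μ : Measure Ω} [IsProbabilityMeasure μ]
  {v w : ℝ≥0} {Φ : Ω → (Fin m → ℝ) × (Fin m → ℝ)}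

theorem integrable_log_whiteGaussianProdPDF (hv : v ≠ 0) (hw : w ≠ 0)
    (h₁ : MemLp (fun ω => toLp 2 (Φ ω).1) 2 μ) (h₂ : MemLp (fun ω => toLp 2 (Φ ω).2) 2 μ) :
    Integrable (fun ω => Real.log (whiteGaussianProdPDF v w (Φ ω))) μ := by
  simp only [log_whiteGaussianProdPDF hv hw]
  exact (integrable_const _).sub (((h₁.integrable_norm_pow two_ne_zero).div_const _).add
    ((h₂.integrable_norm_pow two_ne_zero).div_const _))

theorem integral_log_whiteGaussianProdPDF (hv : v ≠ 0) (hw : w ≠ 0)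
    (h₁ : MemLp (fun ω => toLp 2 (Φ ω).1) 2 μ) (h₂ : MemLp (fun ω => toLp 2 (Φ ω).2) 2 μ) :
    ∫ ω, Real.log (whiteGaussianProdPDF v w (Φ ω)) ∂μ =
      -(m / 2 * (Real.log (2 * Real.pi * v) + Real.log (2 * Real.pi * w))) -
        ((∫ ω, ‖toLp 2 (Φ ω).1‖ ^ 2 ∂μ) / (2 * v) +
          (∫ ω, ‖toLp 2 (Φ ω).2‖ ^ 2 ∂μ) / (2 * w)) := by
  have hfst := (h₁.integrable_norm_pow two_ne_zero).div_const (2 * (v : ℝ))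
  have hsnd := (h₂.integrable_norm_pow two_ne_zero).div_const (2 * (w : ℝ))
  simp only [log_whiteGaussianProdPDF hv hw]
  rw [integral_sub (integrable_const _) (by exact hfst.add hsnd), integral_add hfst hsnd,
    integral_div, integral_div, integral_const, probReal_univ, one_smul]

end CrossEntropy

theorem integral_log_whiteGaussianProdPDF_self {v w : ℝ≥0} (hv : v ≠ 0) (hw : w ≠ 0) :
    ∫ p, Real.log (whiteGaussianProdPDF v w p) ∂(whiteGaussian m v).prod (whiteGaussian m w) =
      -(m / 2 * (Real.log (2 * Real.pi * v) + Real.log (2 * Real.pi * w))) - m := by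
  have hfst : ∫ p, ‖toLp 2 p.1‖ ^ 2 ∂(whiteGaussian m v).prod (whiteGaussian m w) = m * v := by
    rw [integral_fun_fst (fun x : Fin m → ℝ => ‖toLp 2 x‖ ^ 2), probReal_univ, one_smul,
      integral_norm_sq_whiteGaussian]
  have hsnd : ∫ p, ‖toLp 2 p.2‖ ^ 2 ∂(whiteGaussian m v).prod (whiteGaussian m w) = m * w := by
    rw [integral_fun_snd (fun z : Fin m → ℝ => ‖toLp 2 z‖ ^ 2), probReal_univ, one_smul,
      integral_norm_sq_whiteGaussian]
  rw [integral_log_whiteGaussianProdPDF (Φ := fun p => p) hv hw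
    ((memLp_toLp_whiteGaussian m v).comp_fst _) ((memLp_toLp_whiteGaussian m w).comp_snd _),
    hfst, hsnd]
  field_simp
  ring

/-- This is Gibbs' inequality for the law of the argument of `Φ` and the pullback along `Φ` of the
density of `N(0, D I) ⊗ N(0, T I)`, which is a probability density since `Φ` preserves volume. -/
theorem log_sub_log_le_of_measurePreserving
    {Φ : (Fin m → ℝ) × (Fin m → ℝ) → (Fin m → ℝ) × (Fin m → ℝ)} (hΦ : MeasurePreserving Φ)
    {v w D T : ℝ≥0} (hv : v ≠ 0) (hw : w ≠ 0) (hD : D ≠ 0) (hT : T ≠ 0)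
    (h₁ : MemLp (fun p => toLp 2 (Φ p).1) 2 ((whiteGaussian m v).prod (whiteGaussian m w)))
    (h₂ : MemLp (fun p => toLp 2 (Φ p).2) 2 ((whiteGaussian m v).prod (whiteGaussian m w))) :
    m * (Real.log (v * w) - Real.log (D * T) + 2) ≤
      (∫ p, ‖toLp 2 (Φ p).1‖ ^ 2 ∂(whiteGaussian m v).prod (whiteGaussian m w)) / D +
        (∫ p, ‖toLp 2 (Φ p).2‖ ^ 2 ∂(whiteGaussian m v).prod (whiteGaussian m w)) / T := by
  have hmass : ∫⁻ p, ENNReal.ofReal (whiteGaussianProdPDF D T (Φ p)) ≤ 1 := by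
    rw [hΦ.lintegral_comp (f := fun p => ENNReal.ofReal (whiteGaussianProdPDF D T p))
      (by fun_prop), lintegral_whiteGaussianProdPDF hD hT]
  have hΦm := hΦ.measurable
  have gibbs := integral_log_le_integral_log (whiteGaussian_prod_eq_withDensity hv hw)
    (by fun_prop) (whiteGaussianProdPDF_pos hv hw) (by fun_prop)
    (fun p => whiteGaussianProdPDF_pos hD hT (Φ p)) hmass
    (integrable_log_whiteGaussianProdPDF (Φ := fun p => p) hv hw
      ((memLp_toLp_whiteGaussian m v).comp_fst _) ((memLp_toLp_whiteGaussian m w).comp_snd _))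
    (integrable_log_whiteGaussianProdPDF hD hT h₁ h₂)
  rw [integral_log_whiteGaussianProdPDF hD hT h₁ h₂,
    integral_log_whiteGaussianProdPDF_self hv hw] at gibbs
  have hlog {a b : ℝ≥0} (ha : a ≠ 0) (hb : b ≠ 0) : Real.log (2 * Real.pi * a) +
      Real.log (2 * Real.pi * b) = 2 * Real.log (2 * Real.pi) + Real.log (a * b) := by
    have ha' : (a : ℝ) ≠ 0 := NNReal.coe_ne_zero.2 ha
    have hb' : (b : ℝ) ≠ 0 := NNReal.coe_ne_zero.2 hb
    rw [Real.log_mul (by positivity) ha', Real.log_mul (by positivity) hb', Real.log_mul ha' hb']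
    ring
  rw [hlog hD hT, hlog hv hw, mul_comm 2 (D : ℝ), mul_comm 2 (T : ℝ), ← div_div,
    ← div_div] at gibbs
  linarith

theorem sq_mul_le_mul_of_forall_log_le {n c A B : ℝ} (hn : 0 ≤ n) (hc : 0 < c) (hA : 0 ≤ A)
    (hB : 0 ≤ B) (h : ∀ D T : ℝ≥0, D ≠ 0 → T ≠ 0 →
      n * (Real.log c - Real.log (D * T) + 2) ≤ A / D + B / T) :
    n ^ 2 * c ≤ A * B := by
  rcases hn.eq_or_lt with rfl | hn
  · simpa using mul_nonneg hA hB
  -- The optimal `D = A / n` and `T = B / n` may vanish, hence the passage to `a > A` and `b > B`.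
  refine le_mul_of_forall_lt₀ fun a ha b hb => ?_
  have ha0 : 0 < a := hA.trans_lt ha
  have hb0 : 0 < b := hB.trans_lt hb
  have hDT : n * (Real.log c - Real.log (a / n * (b / n)) + 2) ≤ A / (a / n) + B / (b / n) :=
    h ⟨a / n, by positivity⟩ ⟨b / n, by positivity⟩
      (Subtype.coe_ne_coe.1 (div_pos ha0 hn).ne') (Subtype.coe_ne_coe.1 (div_pos hb0 hn).ne')
  have hAn : A / (a / n) ≤ n := by
    rw [div_le_iff₀ (by positivity), mul_div_cancel₀ _ hn.ne']
    exact ha.le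
  have hBn : B / (b / n) ≤ n := by
    rw [div_le_iff₀ (by positivity), mul_div_cancel₀ _ hn.ne']
    exact hb.le
  have hlog : Real.log c ≤ Real.log (a / n * (b / n)) := by
    by_contra! hlt
    nlinarith
  have hle := (Real.log_le_log_iff hc (by positivity)).1 hlog
  calc n ^ 2 * c ≤ n ^ 2 * (a / n * (b / n)) := by gcongr
    _ = a * b := by field_simp

theorem sq_mul_le_mul_of_measurePreserving
    {Φ : (Fin m → ℝ) × (Fin m → ℝ) → (Fin m → ℝ) × (Fin m → ℝ)} (hΦ : MeasurePreserving Φ)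
    {v w : ℝ≥0}
    (h₁ : MemLp (fun p => toLp 2 (Φ p).1) 2 ((whiteGaussian m v).prod (whiteGaussian m w)))
    (h₂ : MemLp (fun p => toLp 2 (Φ p).2) 2 ((whiteGaussian m v).prod (whiteGaussian m w))) :
    m ^ 2 * (v * w : ℝ) ≤
      (∫ p, ‖toLp 2 (Φ p).1‖ ^ 2 ∂(whiteGaussian m v).prod (whiteGaussian m w)) *
        ∫ p, ‖toLp 2 (Φ p).2‖ ^ 2 ∂(whiteGaussian m v).prod (whiteGaussian m w) := by
  rcases eq_or_ne (v * w) 0 with h0 | h0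
  · rw [← NNReal.coe_mul, h0, NNReal.coe_zero, mul_zero]
    positivity
  obtain ⟨hv, hw⟩ := mul_ne_zero_iff.1 h0
  exact sq_mul_le_mul_of_forall_log_le m.cast_nonneg (by positivity) (by positivity)
    (by positivity) fun D T hD hT =>
      log_sub_log_le_of_measurePreserving hΦ hv hw hD hT h₁ h₂

theorem measurePreserving_estimationError_output {G : Type*} [AddCommGroup G] [MeasurableSpace G]
    [MeasurableAdd₂ G] [MeasurableSub₂ G] {κ : Measure G} [SFinite κ] [κ.IsAddLeftInvariant]
    {f g : G → G} (hf : Measurable f) (hg : Measurable g) :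
    MeasurePreserving (fun p : G × G => (p.1 - g (f p.1 + p.2), f p.1 + p.2))
      (κ.prod κ) (κ.prod κ) := by
  have houtput : MeasurePreserving (fun p : G × G => (p.1, f p.1 + p.2)) (κ.prod κ) (κ.prod κ) :=
    (MeasurePreserving.id κ).skew_product (by fun_prop)
      (Eventually.of_forall fun x => map_add_left_eq_self κ (f x))
  have herror : MeasurePreserving (fun p : G × G => (p.1, p.2 - g p.1)) (κ.prod κ) (κ.prod κ) :=
    (MeasurePreserving.id κ).skew_product (by fun_prop)
      (Eventually.of_forall fun y => map_sub_right_eq_self κ (g y))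
  have hswap : MeasurePreserving Prod.swap (κ.prod κ) (κ.prod κ) := Measure.measurePreserving_swap
  exact hswap.comp (herror.comp (hswap.comp houtput))

end EntropyBound

section Hilbert

variable {H : Type*} [NormedAddCommGroup H] [InnerProductSpace ℝ H] {σ P : ℝ≥0} {x y y' : H}

theorem boundTerm_le_norm_sub_sq {γ : ℝ} (hx : ‖x‖ ^ 2 = σ ^ 2) (hxy : ‖x - y‖ ^ 2 ≤ P)
    (hγ : γ ≠ 0) (h : (σ : ℝ) ^ 2 ≤ ‖x - γ • y'‖ ^ 2 * (‖y‖ ^ 2 + 1)) :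
    boundTerm σ P ⟪x, y - x⟫ γ ≤ ‖y - y'‖ ^ 2 := by
  obtain ⟨v, rfl⟩ : ∃ v, y = x + v := ⟨y - x, (add_sub_cancel x y).symm⟩
  rw [sub_add_cancel_left, norm_neg] at hxy
  rw [add_sub_cancel_left]
  have houtput : ‖x + v‖ ^ 2 + 1 ≤ 1 + (σ : ℝ) ^ 2 + P + 2 * ⟪x, v⟫ := by
    rw [norm_add_sq_real, hx]
    linarith
  have hpos : 0 < 1 + (σ : ℝ) ^ 2 + P + 2 * ⟪x, v⟫ :=
    lt_of_lt_of_le (by positivity) houtput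
  have herror : √((σ : ℝ) ^ 2 / (1 + (σ : ℝ) ^ 2 + P + 2 * ⟪x, v⟫)) ≤ ‖x - γ • y'‖ := by
    refine Real.sqrt_le_iff.2 ⟨norm_nonneg _, (div_le_iff₀ hpos).2 (h.trans ?_)⟩
    gcongr
  have hlinear : ‖x - γ • (x + v)‖ ≤
      √((1 - γ) ^ 2 * (σ : ℝ) ^ 2 + γ ^ 2 * P - 2 * γ * (1 - γ) * ⟪x, v⟫) := by
    have hexpand : ‖x - γ • (x + v)‖ ^ 2 =
        (1 - γ) ^ 2 * ‖x‖ ^ 2 + γ ^ 2 * ‖v‖ ^ 2 - 2 * γ * (1 - γ) * ⟪x, v⟫ := by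
      rw [show x - γ • (x + v) = (1 - γ) • x - γ • v by module, norm_sub_sq_real, norm_smul,
        norm_smul, mul_pow, mul_pow, Real.norm_eq_abs, Real.norm_eq_abs, sq_abs, sq_abs,
        real_inner_smul_left, real_inner_smul_right]
      ring
    refine Real.le_sqrt_of_sq_le ?_
    rw [hexpand, hx]
    gcongr
  have htriangle : ‖x - γ • y'‖ ≤ ‖x - γ • (x + v)‖ + |γ| * ‖x + v - y'‖ := by
    rw [← Real.norm_eq_abs, ← norm_smul, smul_sub]
    exact norm_sub_le_norm_sub_add_norm_sub _ _ _
  calc boundTerm σ P ⟪x, v⟫ γ ≤ 1 / γ ^ 2 * (|γ| * ‖x + v - y'‖) ^ 2 := by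
        unfold boundTerm
        gcongr
        exact max_le (by linarith) (by positivity)
    _ = ‖x + v - y'‖ ^ 2 := by
      rw [mul_pow, sq_abs]
      field_simp

theorem lowerBound_le_norm_sub_sq (hx : ‖x‖ ^ 2 = σ ^ 2) (hxy : ‖x - y‖ ^ 2 ≤ P)
    (h : ∀ γ : ℝ, (σ : ℝ) ^ 2 ≤ ‖x - γ • y'‖ ^ 2 * (‖y‖ ^ 2 + 1)) :
    lowerBound σ P ≤ ENNReal.ofReal (‖y - y'‖ ^ 2) := by
  have hcov : |⟪x, y - x⟫| ≤ σ * √(P : ℝ) := by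
    rw [← (pow_left_inj₀ (norm_nonneg x) σ.coe_nonneg two_ne_zero).1 hx]
    refine (abs_real_inner_le_norm x (y - x)).trans
      (mul_le_mul_of_nonneg_left (Real.le_sqrt_of_sq_le ?_) (norm_nonneg x))
    rwa [norm_sub_rev]
  refine (iInf₂_le ⟪x, y - x⟫ hcov).trans (iSup₂_le fun γ hγ => ?_)
  exact ENNReal.ofReal_le_ofReal (boundTerm_le_norm_sub_sq hx hxy hγ (h γ))

theorem lowerBound_mul_le_norm_sub_sq {n : ℝ} (hn : 0 < n) (hx : ‖x‖ ^ 2 = n * σ ^ 2)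
    (hxy : ‖x - y‖ ^ 2 ≤ n * P)
    (h : ∀ γ : ℝ, n ^ 2 * (σ : ℝ) ^ 2 ≤ ‖x - γ • y'‖ ^ 2 * (‖y‖ ^ 2 + n)) :
    lowerBound σ P * ENNReal.ofReal n ≤ ENNReal.ofReal (‖y - y'‖ ^ 2) := by
  have hscale (u : H) : ‖(√n)⁻¹ • u‖ ^ 2 = ‖u‖ ^ 2 / n := by
    rw [norm_smul, mul_pow, norm_inv, inv_pow, Real.norm_eq_abs, sq_abs, Real.sq_sqrt hn.le,
      inv_mul_eq_div]
  rw [← ENNReal.le_div_iff_mul_le (.inl (ENNReal.ofReal_pos.2 hn).ne')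
    (.inl ENNReal.ofReal_ne_top), ← ENNReal.ofReal_div_of_pos hn, ← hscale, smul_sub]
  refine lowerBound_le_norm_sub_sq (x := (√n)⁻¹ • x) ?_ ?_ fun γ => ?_
  · rw [hscale, hx, mul_div_cancel_left₀ _ hn.ne']
  · rw [← smul_sub, hscale, div_le_iff₀' hn]
    exact hxy
  · rw [smul_comm γ, ← smul_sub, hscale, hscale, div_add_one hn.ne',
      div_mul_div_comm, le_div_iff₀' (by positivity), ← sq]
    exact h γ

end Hilbert

section Codes

variable {m N : ℕ} {σ P : ℝ≥0}

theorem sqDist_eq_norm_sq (x y : Fin m → ℝ) : sqDist x y = ‖toLp 2 (x - y)‖ ^ 2 := by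
  simp [sqDist, EuclideanSpace.real_norm_sq_eq]

theorem sq_mul_le_estimationError_mul_output {f g : (Fin m → ℝ) → (Fin m → ℝ)}
    (hf : Measurable f) (hg : Measurable g) {v w : ℝ≥0}
    (herr : MemLp (fun p => toLp 2 (p.1 - g (f p.1 + p.2))) 2
      ((whiteGaussian m v).prod (whiteGaussian m w)))
    (hfm : MemLp (fun x => toLp 2 (f x)) 2 (whiteGaussian m v)) :
    m ^ 2 * (v * w : ℝ) ≤
      (∫ p, ‖toLp 2 (p.1 - g (f p.1 + p.2))‖ ^ 2 ∂(whiteGaussian m v).prod (whiteGaussian m w)) *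
        (∫ x, ‖toLp 2 (f x)‖ ^ 2 ∂whiteGaussian m v + m * w) := by
  have hz := memLp_toLp_whiteGaussian m w
  have hout := (hfm.comp_fst (whiteGaussian m w)).add (hz.comp_snd (whiteGaussian m v))
  refine (sq_mul_le_mul_of_measurePreserving (measurePreserving_estimationError_output hf hg)
    herr hout).trans_eq ?_
  rw [← integral_norm_sq_whiteGaussian m w,
    ← integral_prod_norm_add_sq hfm hz (integral_toLp_whiteGaussian m w)]
  rfl

theorem lowerBound_mul_le_lintegral_sqDist_of_memLp (hm : m ≠ 0)
    {f g : (Fin m → ℝ) → (Fin m → ℝ)} (hf : Measurable f) (hg : Measurable g)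
    (hY : MemLp (fun x => toLp 2 (f x)) 2 (whiteGaussian m (σ ^ 2)))
    (hY' : MemLp (fun p => toLp 2 (g (f p.1 + p.2))) 2
      ((whiteGaussian m (σ ^ 2)).prod (whiteGaussian m 1)))
    (hP : ∫⁻ x, ENNReal.ofReal (sqDist x (f x)) ∂whiteGaussian m (σ ^ 2) ≤ m * P) :
    lowerBound σ P * m ≤ ∫⁻ p, ENNReal.ofReal (sqDist (f p.1) (g (f p.1 + p.2)))
      ∂(whiteGaussian m (σ ^ 2)).prod (whiteGaussian m 1) := by
  set μ := whiteGaussian m (σ ^ 2)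
  set ν := whiteGaussian m 1
  have hm0 : (0 : ℝ) < m := Nat.cast_pos.2 (Nat.pos_of_ne_zero hm)
  have hX₁ := (memLp_toLp_whiteGaussian m (σ ^ 2)).comp_fst ν
  have hY₁ := hY.comp_fst ν
  have hX : ‖hX₁.toLp _‖ ^ 2 = m * (σ : ℝ) ^ 2 := by
    rw [norm_sq_toLp, integral_fun_fst (fun x : Fin m → ℝ => ‖toLp 2 x‖ ^ 2), probReal_univ,
      one_smul, integral_norm_sq_whiteGaussian, NNReal.coe_pow]
  have hpower : ‖hX₁.toLp _ - hY₁.toLp _‖ ^ 2 ≤ m * P := by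
    rw [← ENNReal.ofReal_le_ofReal_iff (by positivity), ← MemLp.toLp_sub, ofReal_norm_sq_toLp,
      ENNReal.ofReal_mul hm0.le, ENNReal.ofReal_natCast, ENNReal.ofReal_coe_nnreal]
    refine le_of_eq_of_le ?_ hP
    simp only [sqDist_eq_norm_sq]
    exact measurePreserving_fst.lintegral_comp
      (f := fun x => ENNReal.ofReal (‖toLp 2 (x - f x)‖ ^ 2)) (by fun_prop)
  have hdist := lowerBound_mul_le_norm_sub_sq (y' := hY'.toLp _) hm0 hX hpower fun γ => ?_
  · rw [ENNReal.ofReal_natCast, ← MemLp.toLp_sub, ofReal_norm_sq_toLp] at hdist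
    simpa only [sqDist_eq_norm_sq, WithLp.toLp_sub, Pi.sub_apply] using hdist
  · have hentropy := sq_mul_le_estimationError_mul_output hf (hg.const_smul γ)
      (hX₁.sub (hY'.const_smul γ)) hY
    rw [← MemLp.toLp_const_smul, ← MemLp.toLp_sub, norm_sq_toLp, norm_sq_toLp,
      integral_fun_fst (fun x => ‖toLp 2 (f x)‖ ^ 2), probReal_univ, one_smul]
    simpa using hentropy

theorem lowerBound_mul_le_lintegral_sqDist (hm : m ≠ 0) {f g : (Fin m → ℝ) → (Fin m → ℝ)}
    (hf : Measurable f) (hg : Measurable g)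
    (hP : ∫⁻ x, ENNReal.ofReal (sqDist x (f x)) ∂whiteGaussian m (σ ^ 2) ≤ m * P) :
    lowerBound σ P * m ≤ ∫⁻ p, ENNReal.ofReal (sqDist (f p.1) (g (f p.1 + p.2)))
      ∂(whiteGaussian m (σ ^ 2)).prod (whiteGaussian m 1) := by
  by_cases htop : ∫⁻ p, ENNReal.ofReal (sqDist (f p.1) (g (f p.1 + p.2)))
      ∂(whiteGaussian m (σ ^ 2)).prod (whiteGaussian m 1) = ∞
  · exact htop ▸ le_top
  have hinput : MemLp (fun x => toLp 2 (x - f x)) 2 (whiteGaussian m (σ ^ 2)) := by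
    refine memLp_two_of_lintegral_norm_sq_ne_top (by fun_prop) ?_
    simp only [← sqDist_eq_norm_sq]
    exact ne_top_of_le_ne_top (ENNReal.mul_ne_top (ENNReal.natCast_ne_top m) ENNReal.coe_ne_top) hP
  have herror : MemLp (fun p => toLp 2 (f p.1 - g (f p.1 + p.2))) 2
      ((whiteGaussian m (σ ^ 2)).prod (whiteGaussian m 1)) := by
    refine memLp_two_of_lintegral_norm_sq_ne_top (by fun_prop) ?_
    simpa only [← sqDist_eq_norm_sq] using htop
  have hmodified : MemLp (fun x => toLp 2 (f x)) 2 (whiteGaussian m (σ ^ 2)) := by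
    simpa only [Pi.sub_def, ← WithLp.toLp_sub, sub_sub_cancel] using
      (memLp_toLp_whiteGaussian m (σ ^ 2)).sub hinput
  refine lowerBound_mul_le_lintegral_sqDist_of_memLp hm hf hg hmodified ?_ hP
  simpa only [Pi.sub_def, ← WithLp.toLp_sub, sub_sub_cancel] using
    (hmodified.comp_fst (whiteGaussian m 1)).sub herror

theorem lowerBound_le_distortion (hm : m ≠ 0) (c : Code m N) (hc : c.PowerConstraint σ P) :
    lowerBound σ P ≤ c.distortion σ := by
  have : NeZero N := ⟨(c.decodeMsg 0).pos.ne'⟩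
  have hencode : Measurable fun q : Fin N × (Fin m → ℝ) => c.encode q.1 q.2 :=
    measurable_from_prod_countable_right c.measurable_encode
  have hdecode := c.measurable_decodeHost
  have hmeas : Measurable fun ω => ENNReal.ofReal
      (sqDist (c.modifiedHost ω) (c.decodeHost (c.channelOutput ω))) := by
    simp only [sqDist_eq_norm_sq, Code.channelOutput, Code.modifiedHost]
    fun_prop
  have : IsProbabilityMeasure (uniformOn (Set.univ : Set (Fin N))) :=
    isProbabilityMeasure_uniformOn Set.finite_univ Set.univ_nonempty
  rw [Code.distortion, ENNReal.le_div_iff_mul_le (.inl (Nat.cast_ne_zero.2 hm))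
    (.inl (ENNReal.natCast_ne_top m)), sourceLaw, lintegral_prod _ hmeas.aemeasurable]
  calc lowerBound σ P * m
      = ∫⁻ _ : Fin N, lowerBound σ P * m ∂uniformOn Set.univ := by simp
    _ ≤ _ := lintegral_mono fun k =>
      lowerBound_mul_le_lintegral_sqDist hm (c.measurable_encode k) hdecode (hc k)

theorem lowerBound_le_MMSE (σ P : ℝ≥0) (R : ℝ) : lowerBound σ P ≤ MMSE σ P R := by
  refine le_iInf₂ fun c hc => le_iInf fun _ => ?_
  refine (le_liminf_of_le (by isBoundedDefault) ?_).trans (liminf_le_limsup (f := atTop))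
  filter_upwards [eventually_ne_atTop 0] with m hm
  exact lowerBound_le_distortion hm (c m) (hc m)

end Codes

end InfoEmbedding

theorem corollary1_general (σ P R : ℝ≥0) :
    InfoEmbedding.lowerBound σ P ≤ InfoEmbedding.MMSE σ P R ∧
    ∀ (m : ℕ), 1 ≤ m → ∀ c : InfoEmbedding.Code m (InfoEmbedding.numMessages m R),
      c.PowerConstraint σ P → InfoEmbedding.lowerBound σ P ≤ c.distortion σ :=
  ⟨InfoEmbedding.lowerBound_le_MMSE σ P R, fun _ hm c hc =>
    InfoEmbedding.lowerBound_le_distortion (Nat.one_le_iff_ne_zero.1 hm) c hc⟩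

theorem corollary1 (σ P : ℝ≥0) :
    InfoEmbedding.lowerBound σ P ≤ InfoEmbedding.MMSE σ P 0 ∧
    ∀ (m : ℕ), 1 ≤ m → ∀ c : InfoEmbedding.Code m (InfoEmbedding.numMessages m 0),
      c.PowerConstraint σ P → InfoEmbedding.lowerBound σ P ≤ c.distortion σ :=
  corollary1_general σ P 0
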